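/- For two groups $G(\circ)$, $G(\ast)$ defined on the same finite set $G$, let $\mathrm{dist}(G(\circ),G(\ast))$ be the number of pairs $(a,b)\in G\times G$ with $a\circ b\neq a\ast b$ (the Hamming distance of their multiplication tables). The Cayley stability of $G(\circ)$ is $$\delta(G(\circ))=\min\{\mathrm{dist}(G(\circ),G(\ast)) : G(\ast)\text{ is a group on the set } G,\ G(\ast)\neq G(\circ)\}.$$ **Theorem.** Every group $G(\circ)$ of prime order $p>7$ has Cayley stability $\delta(G(\circ))=6p-18$. The assumption $p>7$ cannot be weakened to $p\geq 7$: every group $G(\circ)$ of order $7$ has $\delta(G(\circ))=18$, that is, $\delta(\mathbb{Z}_7)=18$, whereas $6\cdot 7-18=24$. -/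

import Mathlib

/-- The Hamming distance of two groups `A`, `B` defined on the same finite set `G`: the number
of pairs `(a, b)` at which their multiplication tables differ. -/
noncomputable def cayleyDist {G : Type*} [Finite G] (A B : Group G) : ℕ :=
  Set.ncard {q : G × G | A.mul q.1 q.2 ≠ B.mul q.1 q.2}

/-- The Cayley stability of a group `A` defined on a finite set `G`: the minimum of the distances
from `A` to the groups on `G` that are different from `A`. (Two terms of `Group G` are equal
exactly when their multiplications agree. The minimum exists as soon as there is another group
on `G`; the infimum of the empty set of natural numbers is `0`, whereas all distances between
different groups are positive.) -/
noncomputable def cayleyStability {G : Type*} [Finite G] (A : Group G) : ℕ :=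
  sInf {d : ℕ | ∃ B : Group G, B ≠ A ∧ d = cayleyDist A B}

/-! Every group on a set of prime order `p` is a copy of `ZMod p`, so the distance between two of
them is the number of pairs at which a permutation `f` of `ZMod p` fails to be additive
(`cayleyDist_eq_defect`), and the groups coincide exactly when `f` is additive. The task is to
minimise `defect f` over non-additive permutations. The swap of `1` and `-1` gives the upper bound
`6p - 18` (`defect_swap_le`).

For the lower bound suppose `defect f < 6p - 18`. Every row `a ≠ 0` has at least `3` defects
(`three_le_rowDefect`), and the least such row has `m ≤ 5`. Subtracting the linear map that agrees
with `f` on this row leaves all row defects unchanged and yields `c` with `c a = 0`. Now `c` takes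
at most `m` values (`card_image_le_rowDefect`), so some fibre is large. A row `b` with `c b ≠ 0`
shifts values by `c b`, and therefore has at least as many defects as the largest fibre has elements
(`levelCard_le_rowDefect`). The count then splits by the support of `c`: two or three points, where
the bound can be sharp; larger support with at least `7` zeros, where a product estimate suffices;
at most `6` zeros.

The last case needs a gain when all fibres have at most `5` elements: a superlevel set of `c` that
loses only one point under a translation is an arithmetic progression, whose difference is unique up
to sign, so most rows of the support lose at least two (`sum_support_rowDefect_ge`). If `f 0 ≠ 0`,
two rows consist of defects only, and this case is excluded by counting. What remains, `p = 11`, `p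
= 13`, and `p = 17` with `m = 3`, is settled by a kernel-checked search.

For `p = 7` the bound of `3` per nonzero row is attained in all six rows. -/

namespace CayleyStability

open Finset

/-! ### Defects of a single row. -/

section Rows

variable {p : ℕ} [Fact p.Prime]

/-- The number of places where `c` fails to be additive in the row of `a`. -/
def rowDefect (c : ZMod p → ZMod p) (a : ZMod p) : ℕ := #{x | c (x + a) ≠ c x + c a}

/-- The number of pairs at which `c` fails to be additive. -/
def defect (c : ZMod p → ZMod p) : ℕ := ∑ a, rowDefect c a

/-- Linear maps are additive, so they can be subtracted freely; this is used to make a chosen row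
value vanish. -/
lemma rowDefect_sub_mul (c : ZMod p → ZMod p) (l a : ZMod p) :
    rowDefect (fun x => c x - l * x) a = rowDefect c a := by
  unfold rowDefect
  congr 1
  ext x
  simp only [mem_filter, mem_univ, true_and]
  refine not_congr ⟨fun h => ?_, fun h => ?_⟩
  · linear_combination h
  · linear_combination h

lemma defect_sub_mul (c : ZMod p → ZMod p) (l : ZMod p) :
    defect (fun x => c x - l * x) = defect c :=
  sum_congr rfl fun a _ => rowDefect_sub_mul c l a

/-- A nonempty proper subset of a group of prime order is not closed under a translation. -/
lemma exists_add_notMem {V : Finset (ZMod p)} {u : ZMod p} (hu : u ≠ 0) (hV : V.Nonempty)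
    (hV' : V ≠ univ) : ∃ v ∈ V, v + u ∉ V := by
  by_contra! h
  obtain ⟨v, hv⟩ := hV
  have key : ∀ n : ℕ, v + n * u ∈ V := by
    intro n
    induction n with
    | zero => simpa using hv
    | succ n ih =>
      have := h _ ih
      convert this using 1
      push_cast
      ring
  refine hV' (eq_univ_iff_forall.2 fun w => ?_)
  have := key ((w - v) / u).val
  rw [ZMod.natCast_val, ZMod.cast_id] at this
  convert this using 1
  field_simp
  ring

lemma rowDefect_of_eq_zero {f : ZMod p → ZMod p} (hf : f.Injective) {a : ZMod p} (ha : a ≠ 0)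
    (h : f a = 0) : rowDefect f a = p := by
  unfold rowDefect
  rw [filter_true_of_mem, card_univ, ZMod.card]
  intro x _ hx
  rw [h, add_zero] at hx
  exact ha (by simpa using hf hx)

lemma rowDefect_zero_of_ne {f : ZMod p → ZMod p} (h : f 0 ≠ 0) : rowDefect f 0 = p := by
  unfold rowDefect
  rw [filter_true_of_mem, card_univ, ZMod.card]
  intro x _ hx
  exact h (by simpa using hx)

lemma additive_of_rowDefect_eq_zero {f : ZMod p → ZMod p} {a : ZMod p} (ha : a ≠ 0)
    (h : rowDefect f a = 0) (x y : ZMod p) : f (x + y) = f x + f y := by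
  have h1 : ∀ x, f (x + a) = f x + f a := by
    intro x
    have := filter_eq_empty_iff.1 (card_eq_zero.1 h) (mem_univ x)
    simpa using this
  have h0 : f 0 = 0 := by simpa using h1 0
  have key : ∀ n : ℕ, f (n * a) = n * f a := by
    intro n
    induction n with
    | zero => simpa using h0
    | succ n ih =>
      push_cast
      rw [add_mul, one_mul, h1, ih]
      ring
  have lin : ∀ x, f x = x / a * f a := by
    intro x
    have := key (x / a).val
    rw [ZMod.natCast_val, ZMod.cast_id, div_mul_cancel₀ _ ha] at this
    exact this
  rw [lin, lin x, lin y]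
  ring

lemma sign_addRight (hp : p ≠ 2) (a : ZMod p) : Equiv.Perm.sign (Equiv.addRight a) = 1 := by
  have h1 : (Equiv.addRight a) ^ p = 1 := by
    ext x
    simp
  have h2 := congrArg Equiv.Perm.sign h1
  rw [map_pow, map_one] at h2
  rcases Int.units_eq_one_or (Equiv.Perm.sign (Equiv.addRight a)) with h | h
  · exact h
  · rw [h, ((Fact.out : p.Prime).odd_of_ne_two hp).neg_one_pow] at h2
    exact absurd h2 (by decide)

/-- Zero defects in a nonzero row force additivity. One defect contradicts the vanishing of the sum
of all deviations in the row. Two defects would make an even permutation, built from translations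
and a conjugate of a translation, into a transposition. -/
lemma three_le_rowDefect {f : ZMod p → ZMod p} (hp : p ≠ 2) (hf : f.Injective)
    (hadd : ¬ ∀ x y, f (x + y) = f x + f y) {a : ZMod p} (ha : a ≠ 0) :
    3 ≤ rowDefect f a := by
  have hn0 : rowDefect f a ≠ 0 := fun h => hadd (additive_of_rowDefect_eq_zero ha h)
  have hn1 : rowDefect f a ≠ 1 := by
    intro h
    obtain ⟨y, hy⟩ := card_eq_one.1 h
    have hmem : ∀ x, f (x + a) ≠ f x + f a ↔ x = y := by
      intro x
      have := congrArg (x ∈ ·) hy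
      simpa using this
    have h0 : ∑ x, (f (x + a) - f x - f a) = 0 := by
      have h1 : ∑ x, f (x + a) = ∑ x, f x := Equiv.sum_comp (Equiv.addRight a) f
      rw [sum_sub_distrib, sum_sub_distrib, h1]
      simp
    rw [sum_eq_single y] at h0
    · exact (hmem y).2 rfl (by linear_combination h0)
    · intro b _ hb
      have := not_not.1 (mt (hmem b).1 hb)
      rw [this]
      ring
    · simp
  have hn2 : rowDefect f a ≠ 2 := by
    intro h
    let F : Equiv.Perm (ZMod p) := Equiv.ofBijective f (Finite.injective_iff_bijective.1 hf)
    have hs : Equiv.Perm.sign ((Equiv.addRight a)⁻¹ * (F⁻¹ * Equiv.addRight (f a) * F)) = 1 := by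
      rw [map_mul, map_mul, map_mul, Equiv.Perm.sign_inv, Equiv.Perm.sign_inv, sign_addRight hp,
        sign_addRight hp, one_mul, mul_one, Int.units_mul_self]
    -- The points moved by this permutation are exactly the defects of row `a`.
    have hc : #((Equiv.addRight a)⁻¹ * (F⁻¹ * Equiv.addRight (f a) * F)).support = 2 := by
      rw [← h]
      unfold rowDefect
      congr 1
      ext x
      simp only [Equiv.Perm.mem_support, mem_filter, mem_univ, true_and]
      refine not_congr ?_
      rw [Equiv.Perm.mul_apply, Equiv.Perm.inv_eq_iff_eq, Equiv.Perm.mul_apply,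
        Equiv.Perm.mul_apply, Equiv.Perm.inv_eq_iff_eq]
      exact eq_comm
    rw [Equiv.Perm.card_support_eq_two] at hc
    rw [hc.sign_eq] at hs
    exact absurd hs (by decide)
  omega

end Rows

/-! ### Fibres, superlevel sets and the support of `c`. -/

section Levels

variable {p : ℕ} [Fact p.Prime]

/-- The size of the fibre of `c` over `v`. -/
def levelCard (c : ZMod p → ZMod p) (v : ZMod p) : ℕ := #{x | c x = v}

/-- The values that `c` takes more than `t` times. -/
def superlevel (c : ZMod p → ZMod p) (t : ℕ) : Finset (ZMod p) := {v | t < levelCard c v}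

/-- The number of elements of `V` that the translation by `u` moves out of `V`. -/
def boundaryCard (V : Finset (ZMod p)) (u : ZMod p) : ℕ := #{v ∈ V | v + u ∉ V}

lemma sum_levelCard (c : ZMod p → ZMod p) : ∑ v, levelCard c v = p := by
  have := card_eq_sum_card_fiberwise (f := c) (s := univ) (t := univ) (fun _ _ => mem_univ _)
  rw [card_univ, ZMod.card] at this
  exact this.symm

lemma one_le_boundaryCard {V : Finset (ZMod p)} {u : ZMod p} (hu : u ≠ 0) (hV : V.Nonempty)
    (hV' : V ≠ univ) : 1 ≤ boundaryCard V u := by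
  obtain ⟨v, hv, hv'⟩ := exists_add_notMem hu hV hV'
  exact card_pos.2 ⟨v, mem_filter.2 ⟨hv, hv'⟩⟩

/-- Translation by `a` maps the non-defects in the fibre over `v` injectively into the fibre over `v
+ c a`; the excess consists of defects. The subtraction is truncated, so only positive excesses
count. -/
lemma sum_levelCard_sub_le_rowDefect (c : ZMod p → ZMod p) (a : ZMod p) :
    ∑ v, (levelCard c v - levelCard c (v + c a)) ≤ rowDefect c a := by
  unfold rowDefect
  rw [card_eq_sum_card_fiberwise (f := c) (t := univ) (fun _ _ => mem_univ _)]
  refine sum_le_sum fun v _ => ?_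
  have h1 : levelCard c v =
      #{x ∈ ({x | c x = v} : Finset (ZMod p)) | c (x + a) ≠ c x + c a} +
      #{x ∈ ({x | c x = v} : Finset (ZMod p)) | ¬ c (x + a) ≠ c x + c a} :=
    (card_filter_add_card_filter_not _).symm
  have h2 : #{x ∈ ({x | c x = v} : Finset (ZMod p)) | ¬ c (x + a) ≠ c x + c a} ≤
      levelCard c (v + c a) := by
    refine card_le_card_of_injOn (· + a) (fun x hx => ?_) (fun x _ y _ h => by simpa using h)
    simp only [mem_coe, mem_filter, mem_univ, true_and, not_not] at hx ⊢
    rw [hx.2, hx.1]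
  rw [filter_comm]
  omega

/-- Layer-cake form of the preceding bound: a drop of fibre size from `v` to `v + c a` is counted
once for each level `t` in between. -/
lemma sum_boundaryCard_le_rowDefect (c : ZMod p → ZMod p) (a : ZMod p) (M : ℕ) :
    ∑ t ∈ range M, boundaryCard (superlevel c t) (c a) ≤ rowDefect c a := by
  refine le_trans ?_ (sum_levelCard_sub_le_rowDefect c a)
  have h1 : ∀ t, boundaryCard (superlevel c t) (c a) =
      ∑ v, if levelCard c (v + c a) ≤ t ∧ t < levelCard c v then 1 else 0 := by
    intro t
    rw [← card_filter]
    unfold boundaryCard superlevel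
    congr 1
    ext v
    simp [and_comm]
  simp_rw [h1]
  rw [sum_comm]
  refine sum_le_sum fun v _ => ?_
  rw [← card_filter, ← Nat.card_Ico]
  refine card_le_card fun t ht => ?_
  simp only [mem_filter, mem_Ico] at ht ⊢
  exact ht.2

lemma superlevel_ne_univ {c : ZMod p → ZMod p} {w : ZMod p} (hw : levelCard c w = 0) (t : ℕ) :
    superlevel c t ≠ univ := by
  intro h
  have := h ▸ mem_univ w
  simp [superlevel, hw] at this

/-- Since `c` omits `w`, every nonempty superlevel set is proper, hence loses a point under
translation by `c a`; there are at least `levelCard c v` nonempty ones. -/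
lemma levelCard_le_rowDefect {c : ZMod p → ZMod p} {w : ZMod p} (hw : levelCard c w = 0)
    {a : ZMod p} (ha : c a ≠ 0) (v : ZMod p) : levelCard c v ≤ rowDefect c a := by
  refine le_trans ?_ (sum_boundaryCard_le_rowDefect c a (levelCard c v))
  calc levelCard c v = ∑ t ∈ range (levelCard c v), 1 := by simp
    _ ≤ _ := sum_le_sum fun t ht => one_le_boundaryCard ha
      ⟨v, by simpa [superlevel] using ht⟩ (superlevel_ne_univ hw t)

/-- The number of values of `c` is at most the defect of any row where `c` vanishes. -/
lemma card_image_le_rowDefect {c : ZMod p → ZMod p} (hc : ∃ x, c x ≠ 0) {a : ZMod p} (ha : a ≠ 0)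
    (hca : c a = 0) : #(univ.image c) ≤ rowDefect c a := by
  refine le_trans (card_le_card fun v hv => ?_)
    (card_image_le (s := ({x | c (x + a) ≠ c x + c a} : Finset (ZMod p))) (f := c))
  obtain ⟨y, -, hy⟩ := mem_image.1 hv
  -- As `c a = 0`, a defect is a point where translation by `a` leaves the fibre. Each fibre is
  -- nonempty and proper, so it contains one.
  obtain ⟨x, hx, hx'⟩ := exists_add_notMem (V := {x | c x = v}) ha ⟨y, by simpa using hy⟩ (by
    intro h
    have h' : ∀ x, c x = v := by simpa [Finset.ext_iff] using h
    obtain ⟨x, hx⟩ := hc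
    exact hx (by rw [h' x, ← h' a, hca]))
  simp only [mem_filter, mem_univ, true_and] at hx hx'
  refine mem_image.2 ⟨x, ?_, hx⟩
  simpa [hx, hca] using hx'

lemma levelCard_eq_zero_iff {c : ZMod p → ZMod p} {w : ZMod p} :
    levelCard c w = 0 ↔ w ∉ univ.image c := by
  simp [levelCard, filter_eq_empty_iff]

lemma exists_levelCard_eq_zero {c : ZMod p → ZMod p} (h : #(univ.image c) < p) :
    ∃ w, levelCard c w = 0 := by
  by_contra! h'
  have : univ.image c = univ := eq_univ_iff_forall.2 fun w => by
    by_contra hw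
    exact h' w (levelCard_eq_zero_iff.2 hw)
  rw [this, card_univ, ZMod.card] at h
  exact lt_irrefl _ h

lemma sum_image_levelCard (c : ZMod p → ZMod p) : ∑ v ∈ univ.image c, levelCard c v = p := by
  conv_rhs => rw [← sum_levelCard c]
  exact sum_subset (subset_univ _) fun v _ hv => levelCard_eq_zero_iff.2 hv

/-- The support of `c`. -/
def support (c : ZMod p → ZMod p) : Finset (ZMod p) := {x | c x ≠ 0}

lemma levelCard_zero_add_card_support (c : ZMod p → ZMod p) :
    levelCard c 0 + #(support c) = p := by
  have := card_filter_add_card_filter_not (s := (univ : Finset (ZMod p))) (fun x => c x = 0)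
  rwa [card_univ, ZMod.card] at this

/-- The number of elements of the support of `c` that are translated by `a` into the support. -/
def supportOverlap (c : ZMod p → ZMod p) (a : ZMod p) : ℕ := #{x ∈ support c | x + a ∈ support c}

/-- When `c a = 0`, defects are the points of the symmetric difference of the support and its
translate by `-a`. -/
lemma two_mul_card_support_le (c : ZMod p → ZMod p) {a : ZMod p} (ha : c a = 0) :
    2 * #(support c) ≤ rowDefect c a + 2 * supportOverlap c a := by
  have h1 : #(support c) = supportOverlap c a + #{x ∈ support c | x + a ∉ support c} :=
    (card_filter_add_card_filter_not _).symm
  have h2 : #(support c) = #({x | x + a ∈ support c} : Finset (ZMod p)) := by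
    refine card_bij' (fun x _ => x - a) (fun x _ => x + a) ?_ ?_ ?_ ?_ <;> simp
  have h3 : #({x | x + a ∈ support c} : Finset (ZMod p)) =
      #{x ∈ ({x | x + a ∈ support c} : Finset (ZMod p)) | x ∈ support c} +
      #{x ∈ ({x | x + a ∈ support c} : Finset (ZMod p)) | x ∉ support c} :=
    (card_filter_add_card_filter_not _).symm
  have h4 : #{x ∈ ({x | x + a ∈ support c} : Finset (ZMod p)) | x ∈ support c} =
      supportOverlap c a := by
    unfold supportOverlap
    congr 1
    ext x
    simp [and_comm]
  have h5 : #{x ∈ support c | x + a ∉ support c} +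
      #{x ∈ ({x | x + a ∈ support c} : Finset (ZMod p)) | x ∉ support c} ≤ rowDefect c a := by
    rw [← card_union_of_disjoint]
    · refine card_le_card fun x hx => ?_
      simp only [support, mem_union, mem_filter, mem_univ, true_and, not_not] at hx ⊢
      rw [ha, add_zero]
      rcases hx with ⟨h, h'⟩ | ⟨h, h'⟩
      · rw [h']
        exact h.symm
      · rwa [h']
    · refine disjoint_left.2 fun x hx hx' => ?_
      exact (mem_filter.1 hx').2 (mem_filter.1 hx).1
  omega

/-- Both sides count ordered pairs of distinct points of the support, by their difference `a`. -/
lemma sum_supportOverlap (c : ZMod p → ZMod p) :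
    ∑ a ∈ univ.erase 0, supportOverlap c a = #(support c) * (#(support c) - 1) := by
  have h1 : ∀ a, supportOverlap c a = ∑ x ∈ support c, if x + a ∈ support c then 1 else 0 :=
    fun a => card_filter _ _
  simp_rw [h1]
  rw [sum_comm, ← smul_eq_mul, ← sum_const]
  refine sum_congr rfl fun x hx => ?_
  rw [← card_filter, ← card_erase_of_mem hx]
  refine card_bij' (fun a _ => x + a) (fun y _ => y - x) ?_ ?_ ?_ ?_ <;>
    simp +contextual [sub_eq_zero]

end Levels

/-! ### Arithmetic progressions and the gain in rows of the support. -/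

section Progressions

variable {p : ℕ} [Fact p.Prime]

/-- The translate of `V` arises from `V` by exchanging one point `a` for one point `b`. -/
lemma exists_sum_add_eq {V : Finset (ZMod p)} {u : ZMod p} (h : boundaryCard V u = 1) :
    ∃ a b, ∀ g : ZMod p → ZMod p, ∑ v ∈ V, g (v + u) + g a = ∑ v ∈ V, g v + g b := by
  have hW : #(V.map (Equiv.addRight u).toEmbedding \ V) = 1 := by
    rw [← h]
    refine card_bij' (fun x _ => x - u) (fun x _ => x + u) ?_ ?_ ?_ ?_ <;>
      simp +contextual [sub_eq_add_neg]
  have hW' : #(V \ V.map (Equiv.addRight u).toEmbedding) = 1 := by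
    rw [← hW]
    exact card_sdiff_comm (by rw [card_map])
  obtain ⟨b, hb⟩ := card_eq_one.1 hW
  obtain ⟨a, ha⟩ := card_eq_one.1 hW'
  refine ⟨a, b, fun g => ?_⟩
  have := sum_sdiff_sub_sum_sdiff (s₁ := V) (s₂ := V.map (Equiv.addRight u).toEmbedding) (f := g)
  rw [hb, ha, sum_singleton, sum_singleton, sum_map] at this
  simp only [Equiv.coe_toEmbedding, Equiv.coe_addRight] at this
  linear_combination -this

/-- This is the variance formula of an arithmetic progression. Comparing the power sums of degrees
1, 2 and 3 of `V` and its translate eliminates the two exchanged points, so `u ^ 2` depends on `V`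
alone. -/
lemma sq_difference_of_boundaryCard_eq_one {V : Finset (ZMod p)} {u : ZMod p} (hu : u ≠ 0)
    (h : boundaryCard V u = 1) :
    (#V : ZMod p) ^ 2 * ((#V : ZMod p) ^ 2 - 1) * u ^ 2 =
      12 * (#V * ∑ v ∈ V, v ^ 2 - (∑ v ∈ V, v) ^ 2) := by
  obtain ⟨a, b, hg⟩ := exists_sum_add_eq h
  have e1 : ∑ v ∈ V, v + #V * u + a = ∑ v ∈ V, v + b := by
    have := hg id
    simp only [id, sum_add_distrib, sum_const, nsmul_eq_mul] at this
    exact this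
  have e2 : ∑ v ∈ V, v ^ 2 + 2 * u * ∑ v ∈ V, v + #V * u ^ 2 + a ^ 2 =
      ∑ v ∈ V, v ^ 2 + b ^ 2 := by
    rw [← hg (· ^ 2)]
    have : ∀ v : ZMod p, (v + u) ^ 2 = v ^ 2 + 2 * u * v + u ^ 2 := fun v => by ring
    simp only [this, sum_add_distrib, mul_sum, sum_const, nsmul_eq_mul]
  have e3 : ∑ v ∈ V, v ^ 3 + 3 * u * ∑ v ∈ V, v ^ 2 + 3 * u ^ 2 * ∑ v ∈ V, v + #V * u ^ 3 +
      a ^ 3 = ∑ v ∈ V, v ^ 3 + b ^ 3 := by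
    rw [← hg (· ^ 3)]
    have : ∀ v : ZMod p, (v + u) ^ 3 = v ^ 3 + 3 * u * v ^ 2 + 3 * u ^ 2 * v + u ^ 3 :=
      fun v => by ring
    simp only [this, sum_add_distrib, mul_sum, sum_const, nsmul_eq_mul]
  generalize ((#V : ℕ) : ZMod p) = k at *
  generalize ∑ v ∈ V, v = s at *
  generalize ∑ v ∈ V, v ^ 2 = q at *
  obtain rfl : b = a + k * u := by linear_combination -e1
  have f2 : 2 * s + k * u = 2 * a * k + k ^ 2 * u :=
    mul_left_cancel₀ hu (by linear_combination e2)
  have f3 : 3 * q + 3 * u * s + k * u ^ 2 = k * (3 * a ^ 2 + 3 * a * k * u + k ^ 2 * u ^ 2) :=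
    mul_left_cancel₀ hu (by linear_combination e3)
  linear_combination -4 * k * f3 + (3 * (2 * a * k + (2 * s + k * u - k ^ 2 * u)) +
    6 * k ^ 2 * u) * f2

/-- A set that is an arithmetic progression determines its difference up to the sign. -/
lemma eq_or_eq_neg_of_boundaryCard_eq_one {V : Finset (ZMod p)} (hV : 2 ≤ #V) (hV' : #V + 1 < p)
    {u w : ZMod p} (hu : u ≠ 0) (hw : w ≠ 0) (hu' : boundaryCard V u = 1)
    (hw' : boundaryCard V w = 1) : w = u ∨ w = -u := by
  have ne : ∀ n : ℕ, 0 < n → n < p → (n : ZMod p) ≠ 0 := fun n h0 h1 h =>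
    absurd (Nat.le_of_dvd h0 ((ZMod.natCast_eq_zero_iff n p).1 h)) (by omega)
  have h0 := ne #V (by omega) (by omega)
  have h1 := ne (#V + 1) (by omega) (by omega)
  have h2 := ne (#V - 1) (by omega) (by omega)
  rw [Nat.cast_add, Nat.cast_one] at h1
  rw [Nat.cast_sub (by omega), Nat.cast_one] at h2
  have h3 : (#V : ZMod p) ^ 2 * ((#V : ZMod p) ^ 2 - 1) ≠ 0 := by
    have := mul_ne_zero (pow_ne_zero 2 h0) (mul_ne_zero h1 h2)
    convert this using 1
    ring
  refine sq_eq_sq_iff_eq_or_eq_neg.1 (mul_left_cancel₀ h3 ?_)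
  rw [sq_difference_of_boundaryCard_eq_one hu hu', sq_difference_of_boundaryCard_eq_one hw hw']

/-- Each of the `M` lowest levels contributes at least one defect to every row of the support. For
`t < r` the superlevel set contains `v₀` and `v₁`; if one row `a₁` loses just one point, all such
rows have `c a = ± c a₁`, which leaves at most `2 * M` of the at least `p - M` rows. The others
contribute a second defect. -/
lemma sum_support_rowDefect_ge {c : ZMod p → ZMod p} {M r : ℕ} (hM : ∀ v, levelCard c v ≤ M)
    {v₀ v₁ : ZMod p} (hv₀ : levelCard c v₀ = M) (hv : v₁ ≠ v₀) (hv₁ : r ≤ levelCard c v₁)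
    (hk : #(univ.image c) + 1 < p) :
    #(support c) * M + r * (p - 3 * M) ≤ ∑ a ∈ support c, rowDefect c a := by
  obtain ⟨w, hw⟩ := exists_levelCard_eq_zero (c := c) (by omega)
  have hne : ∀ a ∈ support c, c a ≠ 0 := fun a ha => (mem_filter.1 ha).2
  have hone : ∀ t < M, ∀ a ∈ support c, 1 ≤ boundaryCard (superlevel c t) (c a) := by
    intro t ht a ha
    exact one_le_boundaryCard (hne a ha) ⟨v₀, by simp [superlevel, hv₀, ht]⟩
      (superlevel_ne_univ hw t)
  have hrM : r ≤ M := hv₁.trans (hM v₁)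
  have hrow : ∀ t < M, #(support c) + (if t < r then p - 3 * M else 0) ≤
      ∑ a ∈ support c, boundaryCard (superlevel c t) (c a) := by
    intro t ht
    have hs : #(support c) + #{a ∈ support c | 2 ≤ boundaryCard (superlevel c t) (c a)} ≤
        ∑ a ∈ support c, boundaryCard (superlevel c t) (c a) := by
      rw [card_filter, card_eq_sum_ones, ← sum_add_distrib]
      refine sum_le_sum fun a ha => ?_
      have := hone t ht a ha
      split_ifs <;> omega
    refine le_trans ?_ hs
    split_ifs with htr
    swap
    · simp
    refine Nat.add_le_add_left ?_ _
    have hsplit := card_filter_add_card_filter_not (s := support c)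
      (fun a => 2 ≤ boundaryCard (superlevel c t) (c a))
    have hq := levelCard_zero_add_card_support c
    have hq' := hM 0
    by_cases hex : ∃ a ∈ support c, ¬ 2 ≤ boundaryCard (superlevel c t) (c a)
    · obtain ⟨a₁, ha₁, hb₁⟩ := hex
      have hV : 2 ≤ #(superlevel c t) := by
        rw [← card_pair hv]
        refine card_le_card fun v hv => ?_
        simp only [mem_insert, mem_singleton] at hv
        rcases hv with rfl | rfl
        · simp only [superlevel, mem_filter, mem_univ, true_and]
          omega
        · simp only [superlevel, mem_filter, mem_univ, true_and]
          omega
      have hV' : #(superlevel c t) + 1 < p := by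
        refine lt_of_le_of_lt (Nat.add_le_add_right (card_le_card fun v hv => ?_) 1) hk
        by_contra h
        rw [← levelCard_eq_zero_iff] at h
        simp [superlevel, h] at hv
      have hsub : #{a ∈ support c | ¬ 2 ≤ boundaryCard (superlevel c t) (c a)} ≤
          levelCard c (c a₁) + levelCard c (-c a₁) := by
        refine (card_le_card fun a ha => ?_).trans (card_union_le _ _)
        obtain ⟨ha, hb⟩ := mem_filter.1 ha
        have := hone t ht a ha
        have := hone t ht a₁ ha₁
        simpa using eq_or_eq_neg_of_boundaryCard_eq_one hV hV' (hne a₁ ha₁) (hne a ha)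
          (by omega) (by omega)
      have := hM (c a₁)
      have := hM (-c a₁)
      omega
    · have : #{a ∈ support c | ¬ 2 ≤ boundaryCard (superlevel c t) (c a)} = 0 := by
        rw [card_eq_zero, filter_eq_empty_iff]
        push Not at hex
        simpa only [not_not] using hex
      omega
  calc #(support c) * M + r * (p - 3 * M)
      = ∑ t ∈ range M, (#(support c) + if t < r then p - 3 * M else 0) := by
        rw [sum_add_distrib, sum_const, card_range, smul_eq_mul, mul_comm M, ← sum_filter]
        congr 1
        have : (range M).filter (· < r) = range r := by
          ext t
          simp only [mem_filter, mem_range]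
          omega
        rw [this, sum_const, card_range, smul_eq_mul]
    _ ≤ ∑ t ∈ range M, ∑ a ∈ support c, boundaryCard (superlevel c t) (c a) :=
        sum_le_sum fun t ht => hrow t (mem_range.1 ht)
    _ = ∑ a ∈ support c, ∑ t ∈ range M, boundaryCard (superlevel c t) (c a) := sum_comm
    _ ≤ _ := sum_le_sum fun a _ => sum_boundaryCard_le_rowDefect c a M

end Progressions

/-! ### Supports of two or three points. -/

section SmallSupport

variable {p : ℕ} [Fact p.Prime]

lemma sum_support_add_sum_erase_le_defect (c : ZMod p → ZMod p) :
    ∑ a ∈ support c, rowDefect c a + ∑ a ∈ univ.erase 0 \ support c, rowDefect c a ≤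
      defect c := by
  rw [← sum_union disjoint_sdiff]
  exact sum_le_sum_of_subset (subset_univ _)

lemma le_card_erase_sdiff_support (c : ZMod p → ZMod p) :
    levelCard c 0 - 1 ≤ #(univ.erase 0 \ support c) := by
  have h1 := le_card_sdiff (support c) (univ.erase (0 : ZMod p))
  have h2 : #(univ.erase (0 : ZMod p)) = p - 1 := by
    rw [card_erase_of_mem (mem_univ _), card_univ, ZMod.card]
  have := levelCard_zero_add_card_support c
  omega

lemma le_defect_of_card_support_le_three {c : ZMod p → ZMod p} (hp : 9 ≤ p)
    (h3 : ∀ a, a ≠ 0 → 3 ≤ rowDefect c a)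
    (hS : ∀ a, c a ≠ 0 → levelCard c 0 ≤ rowDefect c a)
    (hs : 2 ≤ #(support c)) (hs' : #(support c) ≤ 3) : 6 * p - 18 ≤ defect c := by
  have hq := levelCard_zero_add_card_support c
  have hdef := sum_support_add_sum_erase_le_defect c
  have hT := le_card_erase_sdiff_support c
  have h1 : #(support c) * levelCard c 0 ≤ ∑ a ∈ support c, rowDefect c a := by
    rw [← smul_eq_mul]
    exact card_nsmul_le_sum _ _ _ fun a ha => hS a (mem_filter.1 ha).2
  have hr : ∑ a ∈ univ.erase 0 \ support c, supportOverlap c a ≤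
      #(support c) * (#(support c) - 1) := by
    rw [← sum_supportOverlap]
    exact sum_le_sum_of_subset sdiff_subset
  have hmem : ∀ a ∈ univ.erase 0 \ support c, a ≠ 0 ∧ c a = 0 := by
    intro a ha
    simpa [support] using ha
  obtain h | h : #(support c) = 2 ∨ #(support c) = 3 := by omega
  -- A row with no overlap has at least `4` defects, any other at least `3`. The overlaps total at
  -- most `2`, giving `2(p - 2) + 4(p - 3) - 2 = 6p - 18`.
  · have h2 : #(univ.erase 0 \ support c) * 4 ≤
        ∑ a ∈ univ.erase 0 \ support c, (rowDefect c a + supportOverlap c a) := by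
      rw [← smul_eq_mul]
      refine card_nsmul_le_sum _ _ _ fun a ha => ?_
      have := h3 a (hmem a ha).1
      have := two_mul_card_support_le c (hmem a ha).2
      omega
    rw [sum_add_distrib] at h2
    rw [h] at h1 hr hq
    omega
  · have h2 : #(univ.erase 0 \ support c) * 6 ≤
        ∑ a ∈ univ.erase 0 \ support c, (rowDefect c a + 2 * supportOverlap c a) := by
      rw [← smul_eq_mul]
      refine card_nsmul_le_sum _ _ _ fun a ha => ?_
      have := two_mul_card_support_le c (hmem a ha).2
      omega
    rw [sum_add_distrib, ← mul_sum] at h2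
    rw [h] at h1 hr hq
    omega

end SmallSupport

/-! ### The exhaustive search for small primes. -/

section Search

/-! The functions of this section are written with recursors, which the kernel unfolds quickly. -/

/-- Counts the positions of two lists with `(y + a) % p ≠ b`. -/
noncomputable def rowCount (p y : ℕ) (L : List ℕ) : List ℕ → ℕ :=
  L.rec (fun _ => 0) fun a _ count S => S.rec 0 fun b S' _ =>
    bif Nat.beq (Nat.mod (Nat.add y a) p) b then count S' else Nat.succ (count S')

/-- Sums `rowCount p y L` over the entries `y` of a list, for the successive tails of another. -/
noncomputable def tableCount (p : ℕ) (L ys : List ℕ) : List ℕ → ℕ :=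
  ys.rec (fun _ => 0) fun y _ count S => Nat.add (rowCount p y L S) (count S.tail)

/-- The number of defects is `0` or at least `6 * p - 18`. -/
def checkCount (p n : ℕ) : Bool := bif Nat.beq n 0 then true else Nat.ble (6 * p - 18) n

/-- Whether all elements of the list satisfy a predicate. -/
noncomputable def forallMem (L : List ℕ) (q : ℕ → Bool) : Bool :=
  L.rec true fun a _ r => bif q a then r else false

/-- Removes `v` from the list. -/
noncomputable def remove (v : ℕ) (L : List ℕ) : List ℕ :=
  L.rec [] fun a _ r => bif Nat.beq a v then r else a :: r

/-- Adds `y` to the list unless it is there. -/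
noncomputable def insertNew (y : ℕ) (E : List ℕ) : List ℕ :=
  bif forallMem E (fun a => bif Nat.beq y a then false else true) then y :: E else E

/-- If `v` does not follow `y`, then `y` and `v - 1` are recorded as values whose successors
appear elsewhere. -/
noncomputable def recordBreak (p y v : ℕ) (E : List ℕ) : List ℕ :=
  bif Nat.beq (Nat.mod (Nat.succ y) p) v then E
  else insertNew y (insertNew (Nat.mod (Nat.add v (Nat.pred p)) p) E)

/-- Checks all completions, with at most `m` breaks, of the reversed list `y :: l` of values, where
`R` contains the values that are not used yet. -/
noncomputable def search (p m k : ℕ) : ℕ → List ℕ → List ℕ → List ℕ → Bool :=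
  k.rec
    (fun y l E _ => bif Nat.ble (recordBreak p y 0 E).length m then
      checkCount p (tableCount p (y :: l).reverse (y :: l).reverse
        ((y :: l).reverse ++ (y :: l).reverse)) else true)
    fun _ continue_ y l E R => forallMem R fun v =>
      bif Nat.ble (recordBreak p y v E).length m then
        continue_ v (y :: l) (recordBreak p y v E) (remove v R) else true

lemma search_eleven : search 11 4 9 1 [0] [] (List.range' 2 9) = true := by decide +kernel

lemma search_thirteen : search 13 4 11 1 [0] [] (List.range' 2 11) = true := by decide +kernel

lemma search_seventeen : search 17 3 15 1 [0] [] (List.range' 2 15) = true := by decide +kernel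

end Search

/-! ### Correctness of the search. -/

section SearchSound

lemma forallMem_iff {L : List ℕ} {q : ℕ → Bool} :
    forallMem L q = true ↔ ∀ a ∈ L, q a = true := by
  induction L with
  | nil => simp [forallMem]
  | cons a L ih =>
    have : forallMem (a :: L) q = bif q a then forallMem L q else false := rfl
    rw [this, List.forall_mem_cons, ← ih]
    cases q a <;> simp

lemma mem_remove {v a : ℕ} {L : List ℕ} : a ∈ remove v L ↔ a ∈ L ∧ a ≠ v := by
  induction L with
  | nil => simp [remove]
  | cons b L ih =>
    have h : remove v (b :: L) = bif Nat.beq b v then remove v L else b :: remove v L := rfl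
    rw [h]
    cases hb : Nat.beq b v
    · have : b ≠ v := Nat.ne_of_beq_eq_false hb
      simp only [cond_false, List.mem_cons, ih]
      constructor
      · rintro (rfl | h) <;> tauto
      · tauto
    · have : b = v := Nat.eq_of_beq_eq_true hb
      simp only [cond_true, List.mem_cons, ih]
      constructor
      · tauto
      · rintro ⟨rfl | h, h'⟩ <;> tauto

lemma insertNew_eq (y : ℕ) (E : List ℕ) : insertNew y E = if y ∈ E then E else y :: E := by
  unfold insertNew
  by_cases h : y ∈ E
  · rw [if_pos h]
    have : ¬ forallMem E (fun a => bif Nat.beq y a then false else true) = true := by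
      rw [forallMem_iff]
      intro h'
      simpa using h' y h
    rw [Bool.eq_false_iff.2 this, cond_false]
  · rw [if_neg h]
    have : forallMem E (fun a => bif Nat.beq y a then false else true) = true := by
      rw [forallMem_iff]
      intro a ha
      have : Nat.beq y a = false := by
        rw [← Bool.not_eq_true, Nat.beq_eq]
        rintro rfl
        exact h ha
      rw [this, cond_false]
    rw [this, cond_true]

lemma rowCount_cons (p y a b : ℕ) (as bs : List ℕ) : rowCount p y (a :: as) (b :: bs) =
    rowCount p y as bs + if (y + a) % p = b then 0 else 1 := by
  have : rowCount p y (a :: as) (b :: bs) = bif Nat.beq ((y + a) % p) b then rowCount p y as bs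
      else rowCount p y as bs + 1 := rfl
  rw [this]
  by_cases h : (y + a) % p = b
  · have : Nat.beq ((y + a) % p) b = true := by
      rw [Nat.beq_eq]
      exact h
    rw [if_pos h, this]
    rfl
  · have : Nat.beq ((y + a) % p) b = false := by
      rw [← Bool.not_eq_true, Nat.beq_eq]
      exact h
    rw [if_neg h, this]
    rfl

lemma rowCount_map_range' {p : ℕ} (y : ℕ) (F : ℕ → ℕ) {n N : ℕ} (h : n ≤ N) (i j : ℕ) :
    rowCount p y ((List.range' i n).map F) ((List.range' j N).map F) =
      ∑ t ∈ range n, if (y + F (i + t)) % p = F (j + t) then 0 else 1 := by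
  induction n generalizing i j N with
  | zero => rfl
  | succ n ih =>
    obtain ⟨N, rfl⟩ : ∃ N', N = N' + 1 := ⟨N - 1, by omega⟩
    rw [List.range'_succ, List.range'_succ, List.map_cons, List.map_cons, rowCount_cons,
      ih (by omega), sum_range_succ']
    congr 1
    refine sum_congr rfl fun t _ => ?_
    rw [add_assoc, add_assoc, add_comm 1 t]

lemma tableCount_map_range' {p : ℕ} (L : List ℕ) (F : ℕ → ℕ) {n N : ℕ} (h : n ≤ N) (i j : ℕ) :
    tableCount p L ((List.range' i n).map F) ((List.range' j N).map F) =
      ∑ t ∈ range n, rowCount p (F (i + t)) L ((List.range' (j + t) (N - t)).map F) := by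
  induction n generalizing i j N with
  | zero => rfl
  | succ n ih =>
    obtain ⟨N, rfl⟩ : ∃ N', N = N' + 1 := ⟨N - 1, by omega⟩
    have : ∀ y ys S, tableCount p L (y :: ys) S = rowCount p y L S + tableCount p L ys S.tail :=
      fun _ _ _ => rfl
    rw [List.range'_succ (n := n), List.map_cons, this, List.range'_succ, List.map_cons,
      List.tail_cons, ih (by omega), sum_range_succ', add_comm]
    congr 1
    refine sum_congr rfl fun t _ => ?_
    rw [add_assoc, add_assoc, add_comm 1 t, Nat.add_sub_add_right]

variable {p : ℕ} [Fact p.Prime]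

/-- The values of `f` at which the successor of the value is not the value at the successor. -/
def breakValues (f : ZMod p → ZMod p) : Finset (ZMod p) :=
  ({x | f (x + 1) ≠ f x + 1} : Finset (ZMod p)).image f

/-- The list consists of different break values of `f`. -/
def IsBreakList (f : ZMod p → ZMod p) (E : List ℕ) : Prop :=
  E.Nodup ∧ ∀ y ∈ E, y < p ∧ (y : ZMod p) ∈ breakValues f

lemma IsBreakList.length_le {f : ZMod p → ZMod p} {E : List ℕ} (h : IsBreakList f E) :
    E.length ≤ #(breakValues f) := by
  rw [← List.toFinset_card_of_nodup h.1]
  refine card_le_card_of_injOn (fun y => (y : ZMod p)) (fun y hy => ?_) (fun y hy z hz hyz => ?_)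
  · exact (h.2 y (by simpa using hy)).2
  · have hy' := (h.2 y (by simpa using hy)).1
    have hz' := (h.2 z (by simpa using hz)).1
    have := congrArg ZMod.val hyz
    simpa [ZMod.val_natCast, Nat.mod_eq_of_lt hy', Nat.mod_eq_of_lt hz'] using this

lemma IsBreakList.insertNew {f : ZMod p → ZMod p} {E : List ℕ} (h : IsBreakList f E) {y : ℕ}
    (hy : y < p) (hy' : (y : ZMod p) ∈ breakValues f) : IsBreakList f (insertNew y E) := by
  rw [insertNew_eq]
  split_ifs with hE
  · exact h
  · refine ⟨List.nodup_cons.2 ⟨hE, h.1⟩, fun z hz => ?_⟩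
    rcases List.mem_cons.1 hz with rfl | hz
    · exact ⟨hy, hy'⟩
    · exact h.2 z hz

/-- If `f (x + 1) ≠ f x + 1`, then `f x` is a break value, and so is `f (x + 1) - 1`: were its
successor to follow it, injectivity would place it at `x`. Recording both prunes the search earlier.
-/
lemma IsBreakList.recordBreak {f : ZMod p → ZMod p} (hf : f.Injective) {E : List ℕ}
    (h : IsBreakList f E) (x : ZMod p) :
    IsBreakList f (recordBreak p (f x).val (f (x + 1)).val E) := by
  have hp : 1 < p := (Fact.out : p.Prime).one_lt
  unfold CayleyStability.recordBreak
  by_cases hx : f (x + 1) = f x + 1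
  · have : Nat.beq (Nat.mod (Nat.succ (f x).val) p) (f (x + 1)).val = true := by
      rw [Nat.beq_eq, hx, ZMod.val_add, ZMod.val_one'' hp.ne']
      rfl
    rw [this]
    exact h
  · have : Nat.beq (Nat.mod (Nat.succ (f x).val) p) (f (x + 1)).val = false := by
      rw [← Bool.not_eq_true, Nat.beq_eq]
      intro h'
      refine hx (ZMod.val_injective p ?_)
      rw [ZMod.val_add, ZMod.val_one'' hp.ne']
      exact h'.symm
    rw [this]
    have hlt : Nat.mod (Nat.add (f (x + 1)).val (Nat.pred p)) p < p := Nat.mod_lt _ (by omega)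
    have hcast : ((Nat.mod (Nat.add (f (x + 1)).val (Nat.pred p)) p : ℕ) : ZMod p) =
        f (x + 1) - 1 := by
      have : Nat.mod (Nat.add (f (x + 1)).val (Nat.pred p)) p = ((f (x + 1)).val + (p - 1)) % p :=
        rfl
      rw [this, ZMod.natCast_mod, Nat.cast_add, Nat.cast_sub hp.le, ZMod.natCast_val,
        ZMod.cast_id]
      simp
      ring
    refine (h.insertNew hlt ?_).insertNew (ZMod.val_lt _) ?_
    · rw [hcast]
      obtain ⟨z, hz⟩ := (Finite.injective_iff_surjective.1 hf) (f (x + 1) - 1)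
      refine mem_image.2 ⟨z, mem_filter.2 ⟨mem_univ _, fun hz' => hx ?_⟩, hz⟩
      rw [hz, sub_add_cancel] at hz'
      have := hf hz'
      rw [add_right_cancel this] at hz
      rw [hz, sub_add_cancel]
    · rw [ZMod.natCast_val, ZMod.cast_id]
      exact mem_image.2 ⟨x, mem_filter.2 ⟨mem_univ _, hx⟩, rfl⟩

lemma sum_eq_sum_range (g : ZMod p → ℕ) : ∑ x, g x = ∑ i ∈ range p, g i := by
  refine sum_nbij' ZMod.val (fun i => (i : ZMod p)) ?_ ?_ ?_ ?_ ?_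
  · simp [ZMod.val_lt]
  · simp
  · simp
  · intro i hi
    rw [ZMod.val_natCast, Nat.mod_eq_of_lt (by simpa using hi)]
  · simp

/-- The values of `f` as natural numbers, extended periodically. -/
def natValues (f : ZMod p → ZMod p) (i : ℕ) : ℕ := (f (i : ZMod p)).val

lemma natValues_add_self (f : ZMod p → ZMod p) (i : ℕ) : natValues f (p + i) = natValues f i := by
  simp [natValues]

lemma tableCount_eq_defect (f : ZMod p → ZMod p) :
    tableCount p ((List.range' 0 p).map (natValues f)) ((List.range' 0 p).map (natValues f))
      ((List.range' 0 p).map (natValues f) ++ (List.range' 0 p).map (natValues f)) =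
      defect f := by
  -- The doubled list is one stretch of the periodic extension, so the entry for `a + x` is read
  -- without reduction modulo `p`.
  have h2 : (List.range' 0 p).map (natValues f) ++ (List.range' 0 p).map (natValues f) =
      (List.range' 0 (p + p)).map (natValues f) := by
    rw [← List.range'_append_1, List.map_append, zero_add,
      List.range'_eq_map_range (s := p), List.map_map]
    congr 1
    rw [List.range'_eq_map_range, List.map_map]
    refine List.map_congr_left fun i _ => ?_
    simp [natValues_add_self]
  rw [h2, tableCount_map_range' _ _ (by omega), defect, sum_eq_sum_range]
  refine sum_congr rfl fun a ha => ?_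
  have ha' : a < p := by simpa using ha
  rw [rowCount_map_range' _ _ (by omega), rowDefect, card_filter, sum_eq_sum_range]
  refine sum_congr rfl fun x _ => ?_
  have : (natValues f (0 + a) + natValues f (0 + x)) % p = natValues f (0 + a + x) ↔
      ¬ f ((x : ZMod p) + a) ≠ f x + f a := by
    rw [not_not, ← (ZMod.val_injective p).eq_iff, ZMod.val_add]
    simp only [natValues, zero_add, Nat.cast_add]
    rw [add_comm (x : ZMod p), add_comm (f x).val, eq_comm]
  by_cases h : f ((x : ZMod p) + a) ≠ f x + f a
  · rw [if_pos h, if_neg (mt this.1 (not_not.2 h))]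
  · rw [if_neg h, if_pos (this.2 h)]

/-- Induction along the branch that follows the actual values of `f`: it is never pruned, since the
recorded breaks are distinct break values of `f`, of which there are at most `m`. -/
lemma search_sound {f : ZMod p → ZMod p} (hf : f.Injective) (h0 : f 0 = 0) {m : ℕ}
    (hm : #(breakValues f) ≤ m) (k x y : ℕ) (l E R : List ℕ) (hx : x + 1 + k = p)
    (hl : y :: l = ((List.range' 0 (x + 1)).map (natValues f)).reverse) (hE : IsBreakList f E)
    (hR : ∀ v < p, v ∉ y :: l → v ∈ R) (h : search p m k y l E R = true) :
    checkCount p (defect f) = true := by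
  have hcons : ∀ n, ((List.range' 0 (n + 1)).map (natValues f)).reverse =
      natValues f n :: ((List.range' 0 n).map (natValues f)).reverse := by
    intro n
    rw [List.range'_1_concat]
    simp
  have hy : y = natValues f x := by
    rw [hcons] at hl
    exact (List.cons.inj hl).1
  have hE' : IsBreakList f (recordBreak p y (natValues f (x + 1)) E) := by
    have := hE.recordBreak hf (x : ZMod p)
    rw [hy]
    simpa [natValues] using this
  have hlen := Nat.ble_eq_true_of_le (hE'.length_le.trans hm)
  induction k generalizing x y l E R with
  | zero =>
    have e : search p m 0 y l E R = bif Nat.ble (recordBreak p y 0 E).length m then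
      checkCount p (tableCount p (y :: l).reverse (y :: l).reverse
        ((y :: l).reverse ++ (y :: l).reverse)) else true := rfl
    have hx' : x + 1 = p := hx
    -- The row closes up cyclically: the value after the last one is `f 0`.
    have hv : natValues f (x + 1) = 0 := by
      simp [natValues, hx', h0]
    rw [hv] at hlen
    rw [e, hlen, cond_true, hl, List.reverse_reverse, hx', tableCount_eq_defect] at h
    exact h
  | succ k ih =>
    have e : search p m (k + 1) y l E R = forallMem R fun v =>
      bif Nat.ble (recordBreak p y v E).length m then
        search p m k v (y :: l) (recordBreak p y v E) (remove v R) else true := rfl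
    rw [e, forallMem_iff] at h
    have hnot : natValues f (x + 1) ∉ y :: l := by
      rw [hl]
      simp only [List.mem_reverse, List.mem_map, List.mem_range'_1, not_exists, not_and]
      rintro i ⟨-, hi⟩ hi'
      have h1 := congrArg ZMod.val (hf (ZMod.val_injective p hi'))
      rw [ZMod.val_natCast, ZMod.val_natCast, Nat.mod_eq_of_lt (by omega),
        Nat.mod_eq_of_lt (by omega)] at h1
      omega
    have h1 := h (natValues f (x + 1)) (hR _ (ZMod.val_lt _) hnot)
    rw [hlen, cond_true] at h1
    have hl' : natValues f (x + 1) :: y :: l =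
        ((List.range' 0 (x + 1 + 1)).map (natValues f)).reverse := by
      rw [hcons, ← hl]
    have hE'' : IsBreakList f (recordBreak p (natValues f (x + 1)) (natValues f (x + 1 + 1))
        (recordBreak p y (natValues f (x + 1)) E)) := by
      have := hE'.recordBreak hf ((x + 1 : ℕ) : ZMod p)
      simpa [natValues] using this
    refine ih (x + 1) _ _ _ _ (by omega) hl' hE' ?_ h1 rfl hE''
      (Nat.ble_eq_true_of_le (hE''.length_le.trans hm))
    intro v hv hv'
    rw [List.mem_cons, not_or] at hv'
    exact mem_remove.2 ⟨hR v hv hv'.2, hv'.1⟩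

lemma le_defect_of_search {f : ZMod p → ZMod p} (hf : f.Injective) (h0 : f 0 = 0) (h1 : f 1 = 1)
    (hadd : ¬ ∀ x y, f (x + y) = f x + f y) {m : ℕ} (hm : rowDefect f 1 ≤ m)
    (h : search p m (p - 2) 1 [0] [] (List.range' 2 (p - 2)) = true) : 6 * p - 18 ≤ defect f := by
  have hp := (Fact.out : p.Prime).two_le
  have hb : #(breakValues f) ≤ m := by
    refine card_image_le.trans (le_trans (le_of_eq ?_) hm)
    rw [rowDefect, h1]
  have key := search_sound hf h0 hb (p - 2) 1 1 [0] [] _ (by omega) (by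
    simp [natValues, h0, h1, List.range', ZMod.val_one'' (by omega : p ≠ 1)])
    ⟨List.nodup_nil, by simp⟩ (by
      intro v hv hv'
      simp only [List.mem_cons, List.not_mem_nil, or_false, not_or] at hv'
      rw [List.mem_range'_1]
      omega) h
  have hne : defect f ≠ 0 := by
    intro h0
    have := (sum_eq_zero_iff.1 h0) 1 (mem_univ _)
    exact hadd (additive_of_rowDefect_eq_zero (one_ne_zero) this)
  have e : Nat.beq (defect f) 0 = false := by
    rw [← Bool.not_eq_true, Nat.beq_eq]
    exact hne
  rw [checkCount, e, cond_false] at key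
  exact Nat.le_of_ble_eq_true key

end SearchSound

/-! ### The lower bound for primes above 7. -/

section LowerBound

variable {p : ℕ} [Fact p.Prime]

/-- Scaling argument and value moves the cheapest row to `1` with value `1`, the normalisation that
the search assumes. -/
lemma rowDefect_scale (f : ZMod p → ZMod p) {a b : ZMod p} (ha : a ≠ 0) (hb : b ≠ 0)
    (y : ZMod p) : rowDefect (fun x => f (a * x) / b) y = rowDefect f (a * y) := by
  unfold rowDefect
  refine card_bij' (fun x _ => a * x) (fun x _ => x / a) ?_ ?_ ?_ ?_
  · intro x hx
    simp only [mem_filter, mem_univ, true_and] at hx ⊢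
    intro h
    apply hx
    rw [mul_add, h, add_div]
  · intro x hx
    simp only [mem_filter, mem_univ, true_and] at hx ⊢
    intro h
    apply hx
    rw [mul_add, mul_div_cancel₀ _ ha, ← add_div, div_left_inj' hb] at h
    exact h
  · intro x _
    exact mul_div_cancel_left₀ x ha
  · intro x _
    exact mul_div_cancel₀ x ha

lemma defect_scale (f : ZMod p → ZMod p) {a b : ZMod p} (ha : a ≠ 0) (hb : b ≠ 0) :
    defect (fun x => f (a * x) / b) = defect f := by
  unfold defect
  simp_rw [rowDefect_scale f ha hb]
  exact Equiv.sum_comp (Equiv.mulLeft₀ a ha) (rowDefect f)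

lemma le_defect_of_search_of_row {f : ZMod p → ZMod p} (hf : f.Injective) (h0 : f 0 = 0)
    (hadd : ¬ ∀ x y, f (x + y) = f x + f y) {a : ZMod p} (ha : a ≠ 0) {m : ℕ}
    (hm : rowDefect f a ≤ m)
    (h : search p m (p - 2) 1 [0] [] (List.range' 2 (p - 2)) = true) : 6 * p - 18 ≤ defect f := by
  have hb : f a ≠ 0 := fun h => ha (hf (h.trans h0.symm))
  rw [← defect_scale f ha hb]
  refine le_defect_of_search ?_ ?_ ?_ ?_ (m := m) ?_ h
  · intro x y hxy
    exact mul_left_cancel₀ ha (hf ((div_left_inj' hb).1 hxy))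
  · simp [h0]
  · simp [hb]
  · intro h'
    refine hadd fun x y => ?_
    have := h' (x / a) (y / a)
    rwa [mul_add, mul_div_cancel₀ _ ha, mul_div_cancel₀ _ ha, ← add_div, div_left_inj' hb] at this
  · rw [rowDefect_scale f ha hb, mul_one]
    exact hm

lemma sum_erase_sdiff_support_ge {c : ZMod p → ZMod p} {m : ℕ}
    (hm : ∀ a, a ≠ 0 → m ≤ rowDefect c a) :
    (levelCard c 0 - 1) * m ≤ ∑ a ∈ univ.erase 0 \ support c, rowDefect c a := by
  refine (Nat.mul_le_mul_right m (le_card_erase_sdiff_support c)).trans ?_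
  rw [← smul_eq_mul]
  exact card_nsmul_le_sum _ _ _ fun a ha => hm a (by
    have := (mem_sdiff.1 ha).1
    simpa using this)

/-- Pigeonhole: otherwise the remaining fibres, at most `k - 1` of them, have at most `r - 1`
elements each. -/
lemma exists_ne_le_levelCard {c : ZMod p → ZMod p} {v₀ : ZMod p} (hv : 0 < levelCard c v₀)
    {k r : ℕ} (hk : #(univ.image c) ≤ k) (h : levelCard c v₀ + (k - 1) * (r - 1) < p) :
    ∃ v₁, v₁ ≠ v₀ ∧ r ≤ levelCard c v₁ := by
  by_contra! hlt
  have hv : v₀ ∈ univ.image c := not_not.1 (mt levelCard_eq_zero_iff.2 hv.ne')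
  have h1 := sum_image_levelCard c
  rw [← add_sum_erase _ _ hv] at h1
  have h2 : ∑ v ∈ (univ.image c).erase v₀, levelCard c v ≤ (k - 1) * (r - 1) := by
    refine (sum_le_card_nsmul _ _ (r - 1) fun v hv => ?_).trans ?_
    · have := hlt v (ne_of_mem_erase hv)
      omega
    · rw [smul_eq_mul, card_erase_of_mem hv]
      exact Nat.mul_le_mul_right _ (by omega)
  omega

lemma le_card_image_mul {c : ZMod p → ZMod p} {k M : ℕ} (hk : #(univ.image c) ≤ k)
    (hM : ∀ v, levelCard c v ≤ M) : p ≤ k * M := by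
  rw [← sum_image_levelCard c]
  refine (sum_le_card_nsmul _ _ M fun v _ => hM v).trans ?_
  rw [smul_eq_mul]
  exact Nat.mul_le_mul_right _ hk

lemma card_support_mul_add_le_defect {c : ZMod p → ZMod p} {m M : ℕ}
    (hm : ∀ a, a ≠ 0 → m ≤ rowDefect c a) (hM : ∀ a, c a ≠ 0 → M ≤ rowDefect c a) :
    #(support c) * M + (levelCard c 0 - 1) * m ≤ defect c := by
  refine le_trans (Nat.add_le_add ?_ (sum_erase_sdiff_support_ge hm))
    (sum_support_add_sum_erase_le_defect c)
  rw [← smul_eq_mul]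
  exact card_nsmul_le_sum _ _ _ fun a ha => hM a (mem_filter.1 ha).2

lemma le_defect_of_seven_le {c : ZMod p → ZMod p} (hp : 13 ≤ p)
    (hm : ∀ a, a ≠ 0 → 3 ≤ rowDefect c a) (hS : ∀ a, c a ≠ 0 → levelCard c 0 ≤ rowDefect c a)
    (hs : 4 ≤ #(support c)) (hq : 7 ≤ levelCard c 0) : 6 * p - 18 ≤ defect c := by
  have h1 := card_support_mul_add_le_defect hm hS
  have h2 := levelCard_zero_add_card_support c
  obtain ⟨s, hs⟩ := Nat.exists_eq_add_of_le hs
  obtain ⟨q, hq⟩ := Nat.exists_eq_add_of_le hq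
  rw [hs, hq] at h1 h2
  have : (4 + s) * (7 + q) = 28 + 7 * s + 4 * q + s * q := by ring
  have : 0 ≤ s * q := Nat.zero_le _
  omega

/-- With largest fibre `M`, the bound `M` per support row and `m` per other row suffices for `M ≥
6`, except for `m = 3`, `M = 6`, `p = 17`, which `hpm` excludes. For `M ≤ 5` only `p ≤ 25` is
possible, and the gain from progressions is added. -/
lemma le_defect_of_levelCard_le_six {c : ZMod p → ZMod p} {m : ℕ} (hp : 17 ≤ p) (hm3 : 3 ≤ m)
    (hm5 : m ≤ 5) (hpm : p = 17 → 4 ≤ m) (hm : ∀ a, a ≠ 0 → m ≤ rowDefect c a)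
    (hk : #(univ.image c) ≤ m) (h0 : 0 < levelCard c 0) (hq : levelCard c 0 ≤ 6) :
    6 * p - 18 ≤ defect c := by
  obtain ⟨w, hw⟩ := exists_levelCard_eq_zero (c := c) (by omega)
  obtain ⟨v₀, hv₀⟩ := Finite.exists_max (levelCard c)
  obtain ⟨M, hM⟩ : ∃ M, levelCard c v₀ = M := ⟨_, rfl⟩
  rw [hM] at hv₀
  have hpM := le_card_image_mul hk hv₀
  have h1 := card_support_mul_add_le_defect hm (M := M)
    fun a ha => hM ▸ levelCard_le_rowDefect hw ha v₀
  have h2 := levelCard_zero_add_card_support c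
  have h3 := hv₀ 0
  have hprime : p.Prime := Fact.out
  have h18 : p ≠ 18 := by
    rintro rfl
    exact absurd hprime (by norm_num)
  rcases le_or_gt 7 M with hM7 | hM7
  · have h4 := Nat.mul_le_mul_left #(support c) hM7
    have h5 := Nat.mul_le_mul_left (levelCard c 0 - 1) hm3
    omega
  by_cases hM6 : M = 6
  · subst hM6
    interval_cases m <;> omega
  have extra : ∀ r, M + (m - 1) * (r - 1) < p →
      #(support c) * M + r * (p - 3 * M) + (levelCard c 0 - 1) * m ≤ defect c := by
    intro r hr
    obtain ⟨v₁, hv, hv₁⟩ := exists_ne_le_levelCard (v₀ := v₀) (by omega) hk (hM ▸ hr)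
    exact le_trans (Nat.add_le_add (sum_support_rowDefect_ge hv₀ hM hv hv₁ (by omega))
      (sum_erase_sdiff_support_ge hm)) (sum_support_add_sum_erase_le_defect c)
  have hp25 : p ≤ 25 := hpM.trans (Nat.mul_le_mul hm5 (by omega : M ≤ 5))
  -- A second fibre of size `3` or `4` gives enough gain in every remaining case.
  have e3 := extra 3
  have e4 := extra 4
  clear extra
  have hM4 : 4 ≤ M := by
    by_contra h
    have := hpM.trans (Nat.mul_le_mul hm5 (by omega : M ≤ 3))
    omega
  have hM5 : M ≤ 5 := by omega
  have hpp : p = 17 ∨ p = 19 ∨ p = 23 := by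
    clear h1 h2 h3 e3 e4 hpM
    interval_cases p <;> first | omega | (exact absurd hprime (by norm_num))
  interval_cases m <;> interval_cases M <;> omega

/-- Two bijections, here `f` and multiplication by `l`, cannot differ at exactly one point. -/
lemma two_le_card_support {f : ZMod p → ZMod p} (hf : f.Injective) {l : ZMod p} (hl : l ≠ 0)
    {x : ZMod p} (hx : f x - l * x ≠ 0) : 2 ≤ #(support fun x => f x - l * x) := by
  obtain ⟨y, hy⟩ := Finite.injective_iff_surjective.1 hf (l * x)
  have hne : x ≠ y := by
    rintro rfl
    exact hx (by rw [hy, sub_self])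
  rw [← card_pair hne]
  refine card_le_card fun z hz => mem_filter.2 ⟨mem_univ _, ?_⟩
  rcases mem_insert.1 hz with rfl | hz
  · exact hx
  · rw [mem_singleton.1 hz]
    beta_reduce
    rw [hy, ← mul_sub]
    exact mul_ne_zero hl (sub_ne_zero.2 hne)

lemma sub_one_mul_le_defect {f : ZMod p → ZMod p} {m : ℕ}
    (hm : ∀ a, a ≠ 0 → m ≤ rowDefect f a) : (p - 1) * m ≤ defect f := by
  have h1 := card_nsmul_le_sum (univ.erase (0 : ZMod p)) (rowDefect f) m
    fun a ha => hm a (ne_of_mem_erase ha)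
  rw [card_erase_of_mem (mem_univ _), card_univ, ZMod.card, smul_eq_mul] at h1
  exact h1.trans (sum_le_sum_of_subset (erase_subset _ _))

lemma le_defect_of_two_rows {f : ZMod p → ZMod p} {a b : ZMod p} (hab : a ≠ b)
    (h0 : a = 0) (ha : rowDefect f a = p) (hb : rowDefect f b = p) {m : ℕ}
    (hm : ∀ a, a ≠ 0 → m ≤ rowDefect f a) : 2 * p + (p - 2) * m ≤ defect f := by
  have h1 : _ ≤ ∑ x ∈ univ \ {a, b}, rowDefect f x := card_nsmul_le_sum _ _ m fun x hx => hm x (by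
    rintro rfl
    simp [h0] at hx)
  rw [card_sdiff_of_subset (subset_univ _), card_pair hab, card_univ, ZMod.card, smul_eq_mul] at h1
  have h2 : ∑ x ∈ univ \ {a, b}, rowDefect f x + ∑ x ∈ {a, b}, rowDefect f x =
      ∑ x, rowDefect f x := sum_sdiff (subset_univ _)
  rw [sum_pair hab, ha, hb] at h2
  unfold defect
  omega

/-- A permutation of the integers modulo a prime `p > 7` is additive, or it violates additivity at
no less than `6 * p - 18` pairs. -/
theorem le_defect {f : ZMod p → ZMod p} (hp : 11 ≤ p) (hf : f.Injective)
    (hadd : ¬ ∀ x y, f (x + y) = f x + f y) : 6 * p - 18 ≤ defect f := by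
  by_contra! hlt
  have hprime : p.Prime := Fact.out
  obtain ⟨a, ha, hmin⟩ := exists_min_image (univ.erase (0 : ZMod p)) (rowDefect f)
    ⟨1, by simp⟩
  have ha0 : a ≠ 0 := ne_of_mem_erase ha
  obtain ⟨m, hma⟩ : ∃ m, rowDefect f a = m := ⟨_, rfl⟩
  have hm : ∀ b, b ≠ 0 → m ≤ rowDefect f b := fun b hb => hma ▸ hmin b (by simp [hb])
  have hm3 : 3 ≤ m := hma ▸ three_le_rowDefect (by omega) hf hadd ha0
  obtain ⟨e, he⟩ := Finite.injective_iff_surjective.1 hf 0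
  have hrow : f 0 ≠ 0 → e ≠ 0 ∧ rowDefect f 0 = p ∧ rowDefect f e = p := by
    intro h
    have he0 : e ≠ 0 := by
      rintro rfl
      exact h he
    exact ⟨he0, rowDefect_zero_of_ne h, rowDefect_of_eq_zero hf he0 he⟩
  -- If `f 0 = 0`, compare `(p - 1) * m` with `6p - 18`; `m = 5` is too large precisely when `p ≤
  -- 13`. If `f 0 ≠ 0`, the rows of `0` and of the zero `e` of `f` are full, and `2p + (p - 2) * m`
  -- is compared instead.
  have hm5 : m ≤ 5 ∧ (f 0 ≠ 0 → m ≤ 3 ∧ p ≠ 11) ∧ (f 0 = 0 → p ≤ 13 → m ≤ 4) := by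
    by_cases h : f 0 = 0
    · have h1 := sub_one_mul_le_defect hm
      refine ⟨?_, fun h' => absurd h h', fun _ hp13 => ?_⟩
      · by_contra h6
        have := Nat.mul_le_mul_left (p - 1) (by omega : 6 ≤ m)
        omega
      · by_contra h6
        have := Nat.mul_le_mul_left (p - 1) (by omega : 5 ≤ m)
        omega
    · obtain ⟨he0, h1, h2⟩ := hrow h
      have h3 := le_defect_of_two_rows he0.symm rfl h1 h2 hm
      have h4 : m ≤ 3 := by
        by_contra h6
        have := Nat.mul_le_mul_left (p - 2) (by omega : 4 ≤ m)
        omega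
      refine ⟨by omega, fun _ => ⟨h4, ?_⟩, fun h' => absurd h' h⟩
      rintro rfl
      omega
  obtain ⟨hm5, hm0, hm4⟩ := hm5
  have h11 : p ≠ 11 := by
    rintro rfl
    have h0 : f 0 = 0 := not_not.1 fun h => (hm0 h).2 rfl
    have := le_defect_of_search_of_row hf h0 hadd ha0 (hma.le.trans (hm4 h0 (by omega)))
      search_eleven
    omega
  have h13 : 13 ≤ p := by
    have : p ≠ 12 := by
      rintro rfl
      exact absurd hprime (by norm_num)
    omega
  have hfa : f a ≠ 0 := by
    intro h
    have := rowDefect_of_eq_zero hf ha0 h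
    omega
  obtain ⟨l, hl⟩ : ∃ l, l = f a / a := ⟨_, rfl⟩
  have hl0 : l ≠ 0 := hl ▸ div_ne_zero hfa ha0
  obtain ⟨c, hc⟩ : ∃ c : ZMod p → ZMod p, c = fun x => f x - l * x := ⟨_, rfl⟩
  have hca : c a = 0 := by
    rw [hc, hl]
    simp [ha0]
  have hrc : ∀ b, rowDefect c b = rowDefect f b := fun b => hc ▸ rowDefect_sub_mul f l b
  have hdc : defect c = defect f := hc ▸ defect_sub_mul f l
  have hne : ∃ x, c x ≠ 0 := by
    by_contra! h
    refine hadd fun x y => ?_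
    have h' : ∀ x, f x = l * x := fun x => by
      have := h x
      rw [hc] at this
      exact sub_eq_zero.1 this
    rw [h', h', h', mul_add]
  have hk : #(univ.image c) ≤ m := (card_image_le_rowDefect hne ha0 hca).trans (by
    rw [hrc, hma])
  obtain ⟨w, hw⟩ := exists_levelCard_eq_zero (c := c) (by omega)
  have hS : ∀ b, c b ≠ 0 → ∀ v, levelCard c v ≤ rowDefect c b :=
    fun b hb v => levelCard_le_rowDefect hw hb v
  have hmc : ∀ b, b ≠ 0 → m ≤ rowDefect c b := fun b hb => hrc b ▸ hm b hb
  have hs2 : 2 ≤ #(support c) := by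
    obtain ⟨x, hx⟩ := hne
    rw [hc] at hx ⊢
    exact two_le_card_support hf hl0 hx
  have hq0 : 0 < levelCard c 0 := card_pos.2 ⟨a, by simp [hca]⟩
  rw [← hdc] at hlt
  have hs4 : 4 ≤ #(support c) := by
    by_contra h
    have := le_defect_of_card_support_le_three (by omega) (fun b hb => hm3.trans (hmc b hb))
      (fun b hb => hS b hb 0) hs2 (by omega)
    omega
  have hq6 : levelCard c 0 ≤ 6 := by
    by_contra h
    have := le_defect_of_seven_le h13 (fun b hb => hm3.trans (hmc b hb)) (fun b hb => hS b hb 0)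
      hs4 (by omega)
    omega
  -- Otherwise `m = 3` and `p ≥ 13`, so one of at most three fibres has `5` elements. The full rows
  -- of `0` and `e` lie in the support, whose other rows have at least `5` defects each.
  have h0 : f 0 = 0 := by
    by_contra h
    obtain ⟨he0, h1, h2⟩ := hrow h
    obtain ⟨v, hv⟩ : ∃ v, 5 ≤ levelCard c v := by
      by_contra! h'
      have := le_card_image_mul hk (M := 4) fun v => by
        have := h' v
        omega
      have := hm0 h
      omega
    have hsub : ({0, e} : Finset (ZMod p)) ⊆ support c := by
      intro z hz
      refine mem_filter.2 ⟨mem_univ _, ?_⟩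
      rw [hc]
      rcases mem_insert.1 hz with rfl | hz
      · simpa using h
      · rw [mem_singleton.1 hz]
        beta_reduce
        rw [he, zero_sub]
        exact neg_ne_zero.2 (mul_ne_zero hl0 he0)
    have h3 : _ ≤ ∑ x ∈ support c \ {0, e}, rowDefect c x := card_nsmul_le_sum _ _ 5 fun b hb =>
      hv.trans (hS b (mem_filter.1 (mem_sdiff.1 hb).1).2 v)
    rw [card_sdiff_of_subset hsub, card_pair he0.symm, smul_eq_mul] at h3
    have h4 : ∑ x ∈ support c \ {0, e}, rowDefect c x + ∑ x ∈ {0, e}, rowDefect c x =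
      ∑ x ∈ support c, rowDefect c x := sum_sdiff hsub
    rw [sum_pair he0.symm, hrc, hrc, h1, h2] at h4
    have h5 := sum_erase_sdiff_support_ge fun b hb => hm3.trans (hmc b hb)
    have h6 := sum_support_add_sum_erase_le_defect c
    have h7 := levelCard_zero_add_card_support c
    omega
  rcases (by omega : p = 13 ∨ p = 17 ∨ (13 < p ∧ p ≠ 17)) with rfl | h | h
  · have := le_defect_of_search_of_row hf h0 hadd ha0 (hma.le.trans (hm4 h0 le_rfl))
      search_thirteen
    omega
  · by_cases hm' : m ≤ 3
    · subst h
      have := le_defect_of_search_of_row hf h0 hadd ha0 (hma.le.trans hm') search_seventeen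
      omega
    · have := le_defect_of_levelCard_le_six (by omega) hm3 hm5 (by omega) hmc hk hq0 hq6
      omega
  · have hp17 : 17 ≤ p := by
      by_contra h'
      have : p = 14 ∨ p = 15 ∨ p = 16 := by omega
      rcases this with rfl | rfl | rfl <;> exact absurd hprime (by norm_num)
    have := le_defect_of_levelCard_le_six hp17 hm3 hm5 (by omega) hmc hk hq0 hq6
    omega

end LowerBound

/-! ### A swap attaining the bound. -/

section UpperBound

variable {p : ℕ} [Fact p.Prime]

lemma natCast_ne_zero_of_lt {n : ℕ} (h0 : n ≠ 0) (h : n < p) : (n : ZMod p) ≠ 0 := fun h' =>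
  absurd (Nat.le_of_dvd (Nat.pos_of_ne_zero h0) ((ZMod.natCast_eq_zero_iff n p).1 h')) (by omega)

/-- Subtracting the identity leaves a map supported on `1` and `-1`. Row `0` has no defects, rows
`1` and `-1` at most `p - 2`, rows `2` and `-2` at most `3`, the other `p - 5` at most `4`: together
`2(p - 2) + 6 + 4(p - 5)`. -/
lemma defect_swap_le (hp : 5 ≤ p) : defect (Equiv.swap (1 : ZMod p) (-1)) ≤ 6 * p - 18 := by
  have t1 : (1 : ZMod p) ≠ 0 := one_ne_zero
  have t2 : (2 : ZMod p) ≠ 0 :=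
    mod_cast natCast_ne_zero_of_lt (n := 2) (by omega) (by omega)
  have t3 : (3 : ZMod p) ≠ 0 :=
    mod_cast natCast_ne_zero_of_lt (n := 3) (by omega) (by omega)
  have t4 : (4 : ZMod p) ≠ 0 :=
    mod_cast natCast_ne_zero_of_lt (n := 4) (by omega) (by omega)
  have d1 : (1 : ZMod p) ≠ -1 := fun h => t2 (by linear_combination h)
  have d2 : (2 : ZMod p) ≠ 1 := fun h => t1 (by linear_combination h)
  have d3 : (2 : ZMod p) ≠ -1 := fun h => t3 (by linear_combination h)
  have d4 : (-2 : ZMod p) ≠ 1 := fun h => t3 (by linear_combination -h)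
  have d5 : (-2 : ZMod p) ≠ -1 := fun h => t1 (by linear_combination -h)
  have d6 : (2 : ZMod p) ≠ -2 := fun h => t4 (by linear_combination h)
  rw [← defect_sub_mul _ 1]
  obtain ⟨c, hc⟩ : ∃ c : ZMod p → ZMod p, c = fun x => Equiv.swap 1 (-1) x - 1 * x := ⟨_, rfl⟩
  rw [← hc]
  have c1 : c 1 = -2 := by
    rw [hc]
    beta_reduce
    rw [Equiv.swap_apply_left]
    ring
  have c2 : c (-1) = 2 := by
    rw [hc]
    beta_reduce
    rw [Equiv.swap_apply_right]
    ring
  have c0 : ∀ x, x ≠ 1 → x ≠ -1 → c x = 0 := by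
    intro x h1 h2
    rw [hc]
    beta_reduce
    rw [Equiv.swap_apply_of_ne_of_ne h1 h2]
    ring
  have c00 : c 0 = 0 := c0 _ t1.symm (neg_ne_zero.2 t1).symm
  have r0 : rowDefect c 0 ≤ 0 := by
    unfold rowDefect
    rw [filter_false_of_mem, card_empty]
    intro x _
    rw [c00, add_zero, add_zero, not_not]
  have r2 : ∀ a x y, x ≠ y → c (x + a) = c x + c a → c (y + a) = c y + c a →
      rowDefect c a ≤ p - 2 := by
    intro a x y hxy hx hy
    have h : #(univ \ {x, y} : Finset (ZMod p)) = p - 2 := by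
      rw [card_sdiff_of_subset (subset_univ _), card_pair hxy, card_univ, ZMod.card]
    rw [← h]
    refine card_le_card fun z hz => ?_
    have hz := (mem_filter.1 hz).2
    simp only [mem_sdiff, mem_univ, true_and, mem_insert, mem_singleton, not_or]
    constructor
    · rintro rfl
      exact hz hx
    · rintro rfl
      exact hz hy
  have r1 : rowDefect c 1 ≤ p - 2 := r2 1 0 (-1) (neg_ne_zero.2 t1).symm
    (by rw [zero_add, c00, zero_add]) (by rw [neg_add_cancel, c00, c1, c2, add_neg_cancel])
  have r1' : rowDefect c (-1) ≤ p - 2 := r2 (-1) 0 1 t1.symm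
    (by rw [zero_add, c00, zero_add]) (by rw [add_neg_cancel, c00, c1, c2, neg_add_cancel])
  have r3 : ∀ a, a ≠ 1 → a ≠ -1 → rowDefect c a ≤ #{1, -1, 1 - a, -1 - a} := by
    intro a h1 h2
    refine card_le_card fun x hx => ?_
    have hx := (mem_filter.1 hx).2
    rw [c0 a h1 h2, add_zero] at hx
    simp only [mem_insert, mem_singleton]
    by_contra! h
    refine hx ?_
    rw [c0 x h.1 h.2.1, c0 (x + a) (fun h' => h.2.2.1 (by linear_combination h'))
      (fun h' => h.2.2.2 (by linear_combination h'))]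
  have r4 : rowDefect c 2 ≤ 3 := by
    refine (r3 2 d2 d3).trans ?_
    have : (1 : ZMod p) - 2 = -1 := by ring
    rw [this, insert_eq_of_mem (s := {-1, -1 - 2}) (mem_insert_self _ _)]
    exact card_le_three
  have r5 : rowDefect c (-2) ≤ 3 := by
    refine (r3 (-2) d4 d5).trans ?_
    have : (-1 : ZMod p) - -2 = 1 := by ring
    rw [this, insert_eq_of_mem (s := {-1, 1 - -2, 1}) (by simp)]
    exact card_le_three
  have hT : #({0, 1, -1, 2, -2} : Finset (ZMod p)) = 5 := by
    rw [card_insert_of_notMem, card_insert_of_notMem, card_insert_of_notMem, card_pair d6]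
    · simp [d3.symm, d5.symm]
    · simp [d1, d2.symm, d4.symm]
    · simpa [t1.symm, t2.symm] using t2
  have hsum : ∑ a ∈ ({0, 1, -1, 2, -2} : Finset (ZMod p)), rowDefect c a =
      rowDefect c 0 + (rowDefect c 1 + (rowDefect c (-1) + (rowDefect c 2 + rowDefect c (-2)))) := by
    rw [sum_insert, sum_insert, sum_insert, sum_pair d6]
    · simp [d3.symm, d5.symm]
    · simp [d1, d2.symm, d4.symm]
    · simpa [t1.symm, t2.symm] using t2
  have hrest : ∑ a ∈ univ \ ({0, 1, -1, 2, -2} : Finset (ZMod p)), rowDefect c a ≤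
      (p - 5) * 4 := by
    refine (sum_le_card_nsmul _ _ 4 fun a ha => ?_).trans (le_of_eq ?_)
    · simp only [mem_sdiff, mem_insert, mem_singleton, not_or] at ha
      exact (r3 a ha.2.2.1 ha.2.2.2.1).trans card_le_four
    · rw [card_sdiff_of_subset (subset_univ _), hT, card_univ, ZMod.card, smul_eq_mul]
  have htot : ∑ a ∈ univ \ ({0, 1, -1, 2, -2} : Finset (ZMod p)), rowDefect c a +
      ∑ a ∈ ({0, 1, -1, 2, -2} : Finset (ZMod p)), rowDefect c a = ∑ a, rowDefect c a :=
    sum_sdiff (subset_univ _)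
  unfold defect
  omega

lemma swap_not_additive (hp : 5 ≤ p) :
    ¬ ∀ x y, Equiv.swap (1 : ZMod p) (-1) (x + y) = Equiv.swap 1 (-1) x + Equiv.swap 1 (-1) y := by
  intro h
  have t1 : (1 : ZMod p) ≠ 0 := one_ne_zero
  have t3 : (3 : ZMod p) ≠ 0 :=
    mod_cast natCast_ne_zero_of_lt (n := 3) (by omega) (by omega)
  have t4 : (4 : ZMod p) ≠ 0 :=
    mod_cast natCast_ne_zero_of_lt (n := 4) (by omega) (by omega)
  have h1 := h 1 1
  rw [Equiv.swap_apply_left, Equiv.swap_apply_of_ne_of_ne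
    (fun h => t1 (by linear_combination h)) (fun h => t3 (by linear_combination h))] at h1
  exact t4 (by linear_combination h1)

end UpperBound

/-! ### From groups on a set to permutations of the integers modulo `p`. -/

section Transfer

lemma exists_equiv_zmod {G : Type*} [Finite G] {p : ℕ} [Fact p.Prime] (h : Nat.card G = p)
    (A : Group G) : ∃ e : G ≃ ZMod p, ∀ x y, e (A.mul x y) = e x + e y := by
  subst h
  have : IsCyclic G := isCyclic_of_prime_card rfl
  refine ⟨(zmodCyclicMulEquiv (G := G) this).symm.toEquiv.trans Multiplicative.toAdd, fun x y => ?_⟩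
  exact congrArg Multiplicative.toAdd (map_mul (zmodCyclicMulEquiv (G := G) this).symm x y)

variable {G : Type*} {p : ℕ} [Fact p.Prime] {A B : Group G} {e g : G ≃ ZMod p}

lemma mul_ne_mul_iff (he : ∀ x y, e (A.mul x y) = e x + e y)
    (hg : ∀ x y, g (B.mul x y) = g x + g y) (x y : G) :
    A.mul x y ≠ B.mul x y ↔ g (e.symm (e x + e y)) ≠ g (e.symm (e x)) + g (e.symm (e y)) := by
  rw [← he, Equiv.symm_apply_apply, Equiv.symm_apply_apply, Equiv.symm_apply_apply, ← hg,
    g.injective.ne_iff]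

lemma cayleyDist_eq_defect [Finite G] (he : ∀ x y, e (A.mul x y) = e x + e y)
    (hg : ∀ x y, g (B.mul x y) = g x + g y) :
    cayleyDist A B = defect fun x => g (e.symm x) := by
  have h1 : defect (fun x => g (e.symm x)) =
      #{q : ZMod p × ZMod p | g (e.symm (q.1 + q.2)) ≠ g (e.symm q.1) + g (e.symm q.2)} := by
    rw [card_filter, ← univ_product_univ, sum_product_right]
    refine sum_congr rfl fun a _ => ?_
    rw [rowDefect, card_filter]
  rw [h1, ← Set.ncard_coe_finset, cayleyDist]
  refine Set.ncard_congr (fun q _ => (e q.1, e q.2)) ?_ ?_ ?_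
  · rintro ⟨x, y⟩ h
    simpa using (mul_ne_mul_iff he hg x y).1 h
  · rintro ⟨x, y⟩ ⟨x', y'⟩ - - h
    simpa using h
  · rintro ⟨x, y⟩ h
    refine ⟨(e.symm x, e.symm y), (mul_ne_mul_iff he hg _ _).2 ?_, by simp⟩
    simpa using h

lemma eq_iff_additive (he : ∀ x y, e (A.mul x y) = e x + e y)
    (hg : ∀ x y, g (B.mul x y) = g x + g y) :
    B = A ↔ ∀ x y, g (e.symm (x + y)) = g (e.symm x) + g (e.symm y) := by
  constructor
  · rintro rfl x y
    have := mt (mul_ne_mul_iff he hg (e.symm x) (e.symm y)).2 (fun h => h rfl)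
    simpa using this
  · intro h
    refine Group.ext ?_
    ext x y
    by_contra hne
    exact (mul_ne_mul_iff he hg x y).1 (fun h => hne h.symm) (h _ _)

lemma exists_group (e : G ≃ ZMod p) : ∃ B : Group G, ∀ x y, e (B.mul x y) = e x + e y :=
  ⟨(e.trans Multiplicative.ofAdd).group, fun x y => e.apply_symm_apply (e x + e y)⟩

/-- The Cayley stability of a group of prime order is the least defect of the permutations of the
integers modulo the prime that are not additive. -/
lemma cayleyStability_eq [Finite G] (h : Nat.card G = p) (A : Group G) {d : ℕ}
    (hle : ∀ f : ZMod p → ZMod p, f.Injective → (¬ ∀ x y, f (x + y) = f x + f y) → d ≤ defect f)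
    (hex : ∃ f : Equiv.Perm (ZMod p), (¬ ∀ x y, f (x + y) = f x + f y) ∧ defect f ≤ d) :
    cayleyStability A = d := by
  obtain ⟨e, he⟩ := exists_equiv_zmod h A
  obtain ⟨f, hf, hfd⟩ := hex
  obtain ⟨B, hB⟩ := exists_group (e.trans f)
  refine IsLeast.csInf_eq ⟨⟨B, ?_, ?_⟩, ?_⟩
  · rw [Ne, eq_iff_additive he hB]
    simpa using hf
  · rw [cayleyDist_eq_defect he hB]
    have : (fun x => (e.trans f) (e.symm x)) = f := by
      ext x
      simp
    rw [this]
    exact le_antisymm (hle f f.injective hf) hfd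
  · rintro _ ⟨C, hC, rfl⟩
    obtain ⟨g, hg⟩ := exists_equiv_zmod h C
    rw [cayleyDist_eq_defect he hg]
    exact hle _ (g.injective.comp e.symm.injective) (mt (eq_iff_additive he hg).2 hC)

end Transfer

/-! ### The exceptional order 7. -/

section OrderSeven

instance : Fact (Nat.Prime 7) := ⟨by norm_num⟩

lemma eighteen_le_defect {f : ZMod 7 → ZMod 7} (hf : f.Injective)
    (hadd : ¬ ∀ x y, f (x + y) = f x + f y) : 18 ≤ defect f :=
  sub_one_mul_le_defect fun _ ha => three_le_rowDefect (by norm_num) hf hadd ha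

lemma defect_swap_mul_swap :
    defect (Equiv.swap (1 : ZMod 7) 2 * Equiv.swap 5 6 : Equiv.Perm (ZMod 7)) = 18 := by
  decide

lemma swap_mul_swap_not_additive :
    ¬ ∀ x y, (Equiv.swap (1 : ZMod 7) 2 * Equiv.swap 5 6 : Equiv.Perm (ZMod 7)) (x + y) =
      (Equiv.swap (1 : ZMod 7) 2 * Equiv.swap 5 6 : Equiv.Perm (ZMod 7)) x +
      (Equiv.swap (1 : ZMod 7) 2 * Equiv.swap 5 6 : Equiv.Perm (ZMod 7)) y := by
  decide

end OrderSeven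

end CayleyStability

theorem mainTheorem1 {G : Type*} [Finite G] (A : Group G) :
    (∀ p : ℕ, p.Prime → 7 < p → Nat.card G = p → cayleyStability A = 6 * p - 18) ∧
      (Nat.card G = 7 → cayleyStability A = 18) := by
  refine ⟨fun p hp h7 hG => ?_, fun hG => ?_⟩
  · have : Fact p.Prime := ⟨hp⟩
    have h11 : 11 ≤ p := by
      by_contra h
      have : p = 8 ∨ p = 9 ∨ p = 10 := by omega
      rcases this with rfl | rfl | rfl <;> exact absurd hp (by norm_num)
    exact CayleyStability.cayleyStability_eq hG A
      (fun f hf hadd => CayleyStability.le_defect h11 hf hadd)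
      ⟨_, CayleyStability.swap_not_additive (by omega), CayleyStability.defect_swap_le (by omega)⟩
  · exact CayleyStability.cayleyStability_eq hG A
      (fun f hf hadd => CayleyStability.eighteen_le_defect hf hadd)
      ⟨_, CayleyStability.swap_mul_swap_not_additive, CayleyStability.defect_swap_mul_swap.le⟩
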